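/- Let $\log$ be the principal logarithm, let $B_n$ be the Bernoulli numbers, and let $\gamma_1=\lim_{n\to\infty}\big(\sum_{j=1}^{n}\frac{\log j}{j}-\frac{\log^2 n}{2}\big)$ be the first Stieltjes constant. For $z\in\mathbb{C}\setminus(-\infty,0]$ put $$\psi_1(z)=-\gamma_1-\frac{\log z}{z}-\sum_{n=1}^{\infty}\left(\frac{\log(n+z)}{n+z}-\frac{\log n}{n}\right).$$ Then, as $z\to\infty$ in $|\arg z|<\pi$ (that is, for every $\delta>0$, as $z\to\infty$ in the sector $|\arg z|\le\pi-\delta$), $$\psi_1(z)\sim\frac12\log^2 z-\frac{1}{2z}\log z+\sum_{k=1}^{\infty}\frac{B_{2k}}{2k\,z^{2k}}\left(\sum_{j=1}^{2k-2}\frac1j+\frac{1}{2k-1}-\log z\right)$$ as an asymptotic expansion in the sense of Poincaré: each term on the right is $o$ of the preceding one, and the difference between $\psi_1(z)$ and the sum of the terms up to and including any given one is $o$ of that last term. -/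

import Mathlib

open Filter Topology Asymptotics

/-- The sequence `∑_{j=1}^{n} (log j)/j - (log n)^2/2` whose limit is the first Stieltjes constant. -/
noncomputable def stieltjesOneSeq (n : ℕ) : ℝ :=
  ∑ j ∈ Finset.Icc 1 n, Real.log j / j - Real.log n ^ 2 / 2

/-- The first Stieltjes constant
`γ₁ = lim_{n → ∞} (∑_{j=1}^{n} (log j)/j - (log n)^2/2)`
(the limit exists, see `tendsto_stieltjesOneSeq`). -/
noncomputable def stieltjesOne : ℝ := limUnder atTop stieltjesOneSeq

/-- The `n`-th summand `log(n+z)/(n+z) - (log n)/n` of the series for `ψ₁(z)`. -/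
noncomputable def psiOneSummand (z : ℂ) (n : ℕ) : ℂ :=
  Complex.log (n + z) / (n + z) - Complex.log n / n

/-- The function
`ψ₁(z) = -γ₁ - (log z)/z - ∑_{n ≥ 1} ( log(n+z)/(n+z) - (log n)/n )`
with principal logarithms, for `z` in the complex plane slit along `(-∞, 0]`
(the series converges, see `summable_psiOneSummand`). -/
noncomputable def psiOne (z : ℂ) : ℂ :=
  -(stieltjesOne : ℂ) - Complex.log z / z - ∑' n : ℕ, psiOneSummand z (n + 1)

/-- Asymptotic expansion in the sense of Poincaré, `f ∼ ∑_{n ≥ 0} φ n` along the filter `l`: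
`(φ n)` is an asymptotic sequence, and each partial sum approximates `f` with an
error that is negligible with respect to its last term. -/
def HasAsymptoticExpansion (l : Filter ℂ) (f : ℂ → ℂ) (φ : ℕ → ℂ → ℂ) : Prop :=
  (∀ n, φ (n + 1) =o[l] φ n) ∧
    ∀ n, (fun z => f z - ∑ i ∈ Finset.range (n + 1), φ i z) =o[l] φ n

/-- `z → ∞` in the closed sector `|arg z| ≤ π - δ`. -/
noncomputable def atInftyInSector (δ : ℝ) : Filter ℂ :=
  Bornology.cobounded ℂ ⊓ 𝓟 {z : ℂ | |Complex.arg z| ≤ Real.pi - δ}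

/-- The term `B_{2k}/(2k z^{2k}) * (∑_{j=1}^{2k-2} 1/j + 1/(2k-1) - log z)`, for `k ≥ 1`. -/
noncomputable def bernoulliTerm (k : ℕ) (z : ℂ) : ℂ :=
  ((bernoulli (2 * k) : ℚ) : ℂ) / (2 * (k : ℂ) * z ^ (2 * k)) *
    (∑ j ∈ Finset.Icc 1 (2 * k - 2), 1 / (j : ℂ) + 1 / (2 * (k : ℂ) - 1) - Complex.log z)

/-- The successive terms of the expansion: `(log z)^2/2`, then `-(log z)/(2z)`, and then
`bernoulliTerm k z` for `k = 1, 2, 3, …`. -/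
noncomputable def psiOneTerm : ℕ → ℂ → ℂ
  | 0, z => (1 / 2) * Complex.log z ^ 2
  | 1, z => -(1 / (2 * z)) * Complex.log z
  | n + 2, z => bernoulliTerm (n + 1) z

/-- The series that defines `psiOne` converges absolutely. -/
theorem summable_psiOneSummand (z : ℂ) : Summable fun n : ℕ => psiOneSummand z (n + 1) := by
  rw [summable_nat_add_iff 1]
  refine summable_of_isBigO_nat (g := fun n : ℕ => 1 / (n : ℝ) ^ (3 / 2 : ℝ))
    (Real.summable_one_div_nat_rpow.2 (by norm_num)) ?_
  refine IsBigO.of_bound (7 * ‖z‖) ?_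
  filter_upwards [eventually_ge_atTop (⌈2 * ‖z‖⌉₊ + 1)] with n hn
  have hz : 2 * ‖z‖ ≤ n := (Nat.le_ceil _).trans (by exact_mod_cast (by omega : ⌈2 * ‖z‖⌉₊ ≤ n))
  have hn1 : (1 : ℝ) ≤ n := by exact_mod_cast (by omega : 1 ≤ n)
  have hn0 : (0 : ℝ) < n := by linarith
  have hnc : (n : ℂ) ≠ 0 := by exact_mod_cast hn0.ne'
  have hw : ‖z / n‖ ≤ 1 / 2 := by
    rw [norm_div, Complex.norm_natCast, div_le_iff₀ hn0]; linarith
  have hw1 : (1 : ℂ) + z / n ≠ 0 := by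
    intro h
    have : z / n = -1 := by linear_combination h
    rw [this] at hw; norm_num at hw
  have hnz : (n : ℂ) + z = (n : ℝ) * (1 + z / n) := by push_cast; field_simp
  have hnz0 : (n : ℂ) + z ≠ 0 := by
    rw [hnz]; exact mul_ne_zero (by exact_mod_cast hn0.ne') hw1
  have hlog : Complex.log (n + z) = Real.log n + Complex.log (1 + z / n) := by
    rw [hnz, Complex.log_ofReal_mul hn0 hw1]
  have hlogn : Complex.log n = (Real.log n : ℝ) := by
    rw [Complex.ofReal_log hn0.le]; simp
  have hsm := Complex.norm_log_one_add_half_le_self hw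
  have hkey : psiOneSummand z n =
      (n * Complex.log (1 + z / n) - z * Real.log n) / (n * (n + z)) := by
    rw [psiOneSummand, hlog, hlogn]
    field_simp
    ring
  have hden : (n : ℝ) / 2 ≤ ‖(n : ℂ) + z‖ := by
    have := norm_sub_le ((n : ℂ) + z) z
    rw [add_sub_cancel_right, Complex.norm_natCast] at this
    linarith
  have hL0 : 0 ≤ Real.log n := Real.log_nonneg hn1
  have hL : Real.log n ≤ 2 * (n : ℝ) ^ (1 / 2 : ℝ) := by
    have := Real.log_le_rpow_div hn0.le (ε := 1 / 2) (by norm_num)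
    linarith
  have hS : (1 : ℝ) ≤ (n : ℝ) ^ (1 / 2 : ℝ) := Real.one_le_rpow hn1 (by norm_num)
  have hnum : ‖(n : ℂ) * Complex.log (1 + z / n) - z * Real.log n‖
      ≤ ‖z‖ * (7 / 2 * (n : ℝ) ^ (1 / 2 : ℝ)) := by
    refine (norm_sub_le _ _).trans ?_
    rw [norm_mul, norm_mul, Complex.norm_natCast, Complex.norm_real, Real.norm_of_nonneg hL0]
    have h1 : (n : ℝ) * ‖Complex.log (1 + z / n)‖ ≤ 3 / 2 * ‖z‖ := by
      calc (n : ℝ) * ‖Complex.log (1 + z / n)‖ ≤ n * (3 / 2 * ‖z / n‖) := by gcongr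
        _ = 3 / 2 * ‖z‖ := by rw [norm_div, Complex.norm_natCast]; field_simp
    nlinarith [norm_nonneg z, mul_le_mul_of_nonneg_left hL (norm_nonneg z),
      mul_le_mul_of_nonneg_left hS (norm_nonneg z)]
  rw [hkey, norm_div, norm_mul, Complex.norm_natCast, Real.norm_of_nonneg (by positivity)]
  have hpow : (n : ℝ) ^ (3 / 2 : ℝ) * (n : ℝ) ^ (1 / 2 : ℝ) = n * n := by
    rw [← Real.rpow_add hn0]; norm_num; ring
  have hP : (0 : ℝ) < (n : ℝ) ^ (3 / 2 : ℝ) := by positivity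
  calc _ ≤ ‖z‖ * (7 / 2 * (n : ℝ) ^ (1 / 2 : ℝ)) / (n * (n / 2)) := by gcongr
    _ = 7 * ‖z‖ * (1 / (n : ℝ) ^ (3 / 2 : ℝ)) := by
      rw [mul_one_div, div_eq_div_iff (by positivity) hP.ne']
      linear_combination (7 / 2 * ‖z‖) * hpow

/-- The limit that defines the first Stieltjes constant exists. -/
theorem tendsto_stieltjesOneSeq : Tendsto stieltjesOneSeq atTop (𝓝 stieltjesOne) := by
  refine CauchySeq.tendsto_limUnder ?_
  refine cauchySeq_of_summable_dist ?_
  refine summable_of_isBigO_nat (g := fun n : ℕ => 1 / (n : ℝ) ^ (3 / 2 : ℝ))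
    (Real.summable_one_div_nat_rpow.2 (by norm_num)) ?_
  refine IsBigO.of_bound 4 ?_
  filter_upwards [eventually_ge_atTop 1] with n hn
  have hn1 : (1 : ℝ) ≤ n := by exact_mod_cast hn
  have hn0 : (0 : ℝ) < n := by linarith
  set u : ℝ := Real.log ((n : ℝ) + 1) - Real.log n with hu
  have hu2 : u ≤ 1 / n := by
    have := Real.log_le_sub_one_of_pos (x := ((n : ℝ) + 1) / n) (by positivity)
    rw [Real.log_div (by positivity) hn0.ne'] at this
    calc u ≤ ((n : ℝ) + 1) / n - 1 := this
      _ = 1 / n := by field_simp; ring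
  have hu1 : 1 / ((n : ℝ) + 1) ≤ u := by
    have := Real.log_le_sub_one_of_pos (x := (n : ℝ) / (n + 1)) (by positivity)
    rw [Real.log_div hn0.ne' (by positivity)] at this
    have h2 : (n : ℝ) / (n + 1) - 1 = -(1 / (n + 1)) := by field_simp; ring
    linarith
  have hu0 : 0 ≤ u := le_trans (by positivity) hu1
  have hL0 : 0 ≤ Real.log n := Real.log_nonneg hn1
  have hL : Real.log n ≤ 2 * (n : ℝ) ^ (1 / 2 : ℝ) := by
    have := Real.log_le_rpow_div hn0.le (ε := 1 / 2) (by norm_num)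
    linarith
  have hS : (1 : ℝ) ≤ (n : ℝ) ^ (1 / 2 : ℝ) := Real.one_le_rpow hn1 (by norm_num)
  have hstep : stieltjesOneSeq n - stieltjesOneSeq (n + 1)
      = (Real.log n + u) * (u - 1 / ((n : ℝ) + 1)) - u ^ 2 / 2 := by
    rw [stieltjesOneSeq, stieltjesOneSeq, Finset.sum_Icc_succ_top (by omega)]
    have : Real.log ((n : ℝ) + 1) = Real.log n + u := by rw [hu]; ring
    push_cast
    rw [this]
    ring
  have hin : 1 / (n : ℝ) ≤ 1 := by rw [div_le_one hn0]; exact hn1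
  have hd : u - 1 / ((n : ℝ) + 1) ≤ 1 / (n * n) := by
    have : 1 / (n : ℝ) - 1 / (n + 1) ≤ 1 / (n * n) := by
      rw [div_sub_div _ _ hn0.ne' (by positivity), div_le_div_iff₀ (by positivity) (by positivity)]
      nlinarith
    linarith
  have husq : u ^ 2 ≤ 1 / ((n : ℝ) * n) := by
    calc u ^ 2 ≤ (1 / (n : ℝ)) ^ 2 := by gcongr
      _ = _ := by field_simp
  have hq : 0 < 1 / ((n : ℝ) * n) := by positivity
  have hmul : (Real.log n + u) * (u - 1 / ((n : ℝ) + 1))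
      ≤ 3 * (n : ℝ) ^ (1 / 2 : ℝ) * (1 / (n * n)) := by
    apply mul_le_mul (by linarith) hd (by linarith) (by positivity)
  have hmul0 : 0 ≤ (Real.log n + u) * (u - 1 / ((n : ℝ) + 1)) :=
    mul_nonneg (by linarith) (by linarith)
  have hpow : (n : ℝ) ^ (3 / 2 : ℝ) * (n : ℝ) ^ (1 / 2 : ℝ) = n * n := by
    rw [← Real.rpow_add hn0]; norm_num; ring
  have hP : (0 : ℝ) < (n : ℝ) ^ (3 / 2 : ℝ) := by positivity
  have hfin : (n : ℝ) ^ (1 / 2 : ℝ) * (1 / (n * n)) = 1 / (n : ℝ) ^ (3 / 2 : ℝ) := by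
    rw [mul_one_div, div_eq_div_iff (by positivity) hP.ne']
    linear_combination hpow
  rw [Real.dist_eq, Nat.succ_eq_add_one, hstep, Real.norm_of_nonneg (abs_nonneg _), ← hfin,
    Real.norm_of_nonneg (by positivity), abs_le]
  constructor <;> nlinarith [mul_le_mul_of_nonneg_right hS hq.le, sq_nonneg u]

/-!
The expansion comes from Euler–Maclaurin summation of `f w = log w / w`, whose antiderivative is
`(log w)² / 2` and whose derivatives have the closed form `logDivDeriv`.

By the definition of the first Stieltjes constant, `psiOne z` is the limit of
`(log N)² / 2 - ∑_{n ≤ N} f (z + n)` (`tendsto_psiOne`). Let `S_K` be the sum of the first `K + 2`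
terms of the expansion; its terms of index at least two are `B_{2k} / (2k)! * f^{(2k-1)}`
(`psiOneTerm_add_two`). Repeated integration by parts against Bernoulli polynomials on `[0, 1]` gives
`S_K (z + 1) - S_K z = f z - ∫_0^1 B_{2K+1}(t) / (2K+1)! * f^{(2K+1)}(z + t) dt`
(`sum_psiOneTerm_add_one_sub`). Telescoping this along `z, z + 1, z + 2, …`, where
`S_K (z + N) - (log N)² / 2` tends to zero, shows that `psiOne - S_K` is minus the sum of these
integrals over all the points `z + n` (`tendsto_sum_eulerMaclaurinRemainder`).

In the sector `|arg z| ≤ π - δ` one has `‖z + t‖ ≥ c (‖z‖ + t)` with `c > 0`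
(`le_norm_add_of_abs_arg_le`), and the crude estimate `‖log w‖ = O(‖w‖)` bounds the sum of the
integrals by a power of `1 / z` (`isBigO_psiOne_sub_sum`). For the error after the term of index `n`
it suffices to apply this to the partial sum with two more terms, and to note that the terms form an
asymptotic sequence. The latter uses that `B_{2k} ≠ 0`, which holds because
`ζ(2k) = ∑ 1 / n ^ (2k)` is positive.
-/

/-! ### Derivatives of `log w / w` -/

/-- The `m`-th derivative of `log w / w`, in the closed form
`(-1)^m m! (log w - H_m) / w^(m+1)` with `H_m` the `m`-th harmonic number. -/
noncomputable def logDivDeriv (m : ℕ) (w : ℂ) : ℂ :=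
  (-1) ^ m * (m.factorial : ℂ) * (Complex.log w - ((harmonic m : ℚ) : ℂ)) / w ^ (m + 1)

theorem logDivDeriv_zero (w : ℂ) : logDivDeriv 0 w = Complex.log w / w := by
  simp [logDivDeriv]

theorem hasDerivAt_logDivDeriv (m : ℕ) {w : ℂ} (hw : w ∈ Complex.slitPlane) :
    HasDerivAt (logDivDeriv m) (logDivDeriv (m + 1) w) w := by
  have hw0 : w ≠ 0 := Complex.slitPlane_ne_zero hw
  have hm : (m : ℂ) + 1 ≠ 0 := Nat.cast_add_one_ne_zero m
  have h := ((((Complex.hasDerivAt_log hw).sub_const ((harmonic m : ℚ) : ℂ)).const_mul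
    ((-1) ^ m * (m.factorial : ℂ))).div (hasDerivAt_pow (m + 1) w) (pow_ne_zero _ hw0))
  refine h.congr_deriv ?_
  rw [logDivDeriv, harmonic_succ, Nat.factorial_succ]
  push_cast
  field_simp
  ring

theorem hasDerivAt_log_sq {w : ℂ} (hw : w ∈ Complex.slitPlane) :
    HasDerivAt (fun w => 1 / 2 * Complex.log w ^ 2) (logDivDeriv 0 w) w := by
  refine (((Complex.hasDerivAt_log hw).pow 2).const_mul (1 / 2)).congr_deriv ?_
  rw [logDivDeriv_zero, div_eq_mul_inv]
  push_cast
  ring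

theorem add_ofReal_mem_slitPlane {z : ℂ} (hz : z ∈ Complex.slitPlane) {t : ℝ} (ht : 0 ≤ t) :
    z + t ∈ Complex.slitPlane := by
  rw [Complex.mem_slitPlane_iff] at hz ⊢
  rcases hz with h | h
  · left; simp; linarith
  · right; simpa using h

theorem hasDerivAt_comp_add_ofReal {f : ℂ → ℂ} {f' z : ℂ} {t : ℝ}
    (h : HasDerivAt f f' (z + t)) : HasDerivAt (fun t : ℝ => f (z + t)) f' t := by
  have h1 : HasDerivAt (fun t : ℝ => z + (t : ℂ)) 1 t :=
    (Complex.ofRealCLM.hasDerivAt (x := t)).const_add z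
  exact (h.comp t h1).congr_deriv (mul_one _)

theorem continuousOn_logDivDeriv_add (m : ℕ) {z : ℂ} (hz : z ∈ Complex.slitPlane) :
    ContinuousOn (fun t : ℝ => logDivDeriv m (z + t)) (Set.uIcc 0 1) := by
  intro t ht
  rw [Set.uIcc_of_le zero_le_one] at ht
  exact (hasDerivAt_comp_add_ofReal (hasDerivAt_logDivDeriv m
    (add_ofReal_mem_slitPlane hz ht.1))).continuousAt.continuousWithinAt

/-! ### Euler–Maclaurin summation on a unit interval -/

/-- The normalized Bernoulli polynomial `B_m(t) / m!`, as a complex-valued function. -/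
noncomputable def bernoulliWeight (m : ℕ) (t : ℝ) : ℂ :=
  ((bernoulliFun m t / m.factorial : ℝ) : ℂ)

theorem hasDerivAt_bernoulliWeight (m : ℕ) (t : ℝ) :
    HasDerivAt (bernoulliWeight (m + 1)) (bernoulliWeight m t) t := by
  refine ((hasDerivAt_bernoulliFun (m + 1) t).div_const
    ((m + 1).factorial : ℝ)).ofReal_comp.congr_deriv ?_
  rw [bernoulliWeight, Nat.factorial_succ, Nat.add_sub_cancel]
  have : (m : ℝ) + 1 ≠ 0 := by positivity
  congr 1
  push_cast
  field_simp

theorem continuous_bernoulliWeight (m : ℕ) : Continuous (bernoulliWeight m) :=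
  Complex.continuous_ofReal.comp ((continuous_bernoulliFun m).div_const _)

/-- The integral `∫_0^1 B_m(t)/m! f^{(m)}(z+t) dt` for `f w = log w / w`. -/
noncomputable def eulerMaclaurinRemainder (m : ℕ) (z : ℂ) : ℂ :=
  ∫ t in (0 : ℝ)..1, bernoulliWeight m t * logDivDeriv m (z + t)

theorem eulerMaclaurinRemainder_zero {z : ℂ} (hz : z ∈ Complex.slitPlane) :
    eulerMaclaurinRemainder 0 z =
      1 / 2 * Complex.log (z + 1) ^ 2 - 1 / 2 * Complex.log z ^ 2 := by
  have h := intervalIntegral.integral_eq_sub_of_hasDerivAt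
    (f := fun t : ℝ => 1 / 2 * Complex.log (z + t) ^ 2)
    (f' := fun t : ℝ => logDivDeriv 0 (z + t)) (a := 0) (b := 1)
    (fun t ht => by
      rw [Set.uIcc_of_le zero_le_one] at ht
      exact hasDerivAt_comp_add_ofReal (hasDerivAt_log_sq (add_ofReal_mem_slitPlane hz ht.1)))
    (continuousOn_logDivDeriv_add 0 hz).intervalIntegrable
  simpa [eulerMaclaurinRemainder, bernoulliWeight] using h

/-- Integration by parts, integrating the Bernoulli polynomial and differentiating `log w / w`. -/
theorem eulerMaclaurinRemainder_eq (m : ℕ) {z : ℂ} (hz : z ∈ Complex.slitPlane) :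
    eulerMaclaurinRemainder m z = bernoulliWeight (m + 1) 1 * logDivDeriv m (z + 1)
      - bernoulliWeight (m + 1) 0 * logDivDeriv m z - eulerMaclaurinRemainder (m + 1) z := by
  have h := intervalIntegral.integral_mul_deriv_eq_deriv_mul (a := 0) (b := 1)
    (u := fun t : ℝ => logDivDeriv m (z + t)) (u' := fun t : ℝ => logDivDeriv (m + 1) (z + t))
    (v := bernoulliWeight (m + 1)) (v' := bernoulliWeight m)
    (fun t ht => by
      rw [Set.uIcc_of_le zero_le_one] at ht
      exact hasDerivAt_comp_add_ofReal
        (hasDerivAt_logDivDeriv m (add_ofReal_mem_slitPlane hz ht.1)))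
    (fun t _ => hasDerivAt_bernoulliWeight m t)
    (continuousOn_logDivDeriv_add (m + 1) hz).intervalIntegrable
    ((continuous_bernoulliWeight m).intervalIntegrable 0 1)
  simp only [Complex.ofReal_one, Complex.ofReal_zero, add_zero] at h
  simp only [eulerMaclaurinRemainder, mul_comm (bernoulliWeight _ _)]
  exact h

theorem psiOneTerm_add_two (n : ℕ) (z : ℂ) :
    psiOneTerm (n + 2) z = bernoulliWeight (2 * n + 2) 0 * logDivDeriv (2 * n + 1) z := by
  have hH : ∑ j ∈ Finset.Icc 1 (2 * (n + 1) - 2), 1 / (j : ℂ) + 1 / (2 * ((n + 1 : ℕ) : ℂ) - 1)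
      = ((harmonic (2 * n + 1) : ℚ) : ℂ) := by
    rw [harmonic_succ, harmonic_eq_sum_Icc]
    push_cast
    rw [show 2 * (n + 1) - 2 = 2 * n by omega]
    simp only [one_div]
    congr 2
    ring
  have hn : (2 * (n : ℂ) + 1 + 1) ≠ 0 := by exact_mod_cast Nat.succ_ne_zero (2 * n + 1)
  have hn' : ((n : ℂ) + 1) ≠ 0 := Nat.cast_add_one_ne_zero n
  rw [psiOneTerm, bernoulliTerm, hH, bernoulliWeight, bernoulliFun_eval_zero, logDivDeriv,
    Nat.factorial_succ (2 * n + 1), show 2 * (n + 1) = 2 * n + 1 + 1 by ring]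
  rcases eq_or_ne z 0 with rfl | hz
  · simp
  have hf : ((2 * n + 1).factorial : ℂ) ≠ 0 := by exact_mod_cast Nat.factorial_ne_zero _
  rw [Odd.neg_one_pow ⟨n, rfl⟩]
  push_cast
  field_simp
  ring

/-- The partial sums of the expansion satisfy the difference equation
`S(z+1) - S(z) = log z / z` up to the Euler–Maclaurin remainder. -/
theorem sum_psiOneTerm_add_one_sub (K : ℕ) {z : ℂ} (hz : z ∈ Complex.slitPlane) :
    ∑ i ∈ Finset.range (K + 2), psiOneTerm i (z + 1) - ∑ i ∈ Finset.range (K + 2), psiOneTerm i z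
      = Complex.log z / z - eulerMaclaurinRemainder (2 * K + 1) z := by
  induction K with
  | zero =>
    have h0 := eulerMaclaurinRemainder_zero hz
    have h1 := eulerMaclaurinRemainder_eq 0 hz
    have hz0 := Complex.slitPlane_ne_zero hz
    have hz1 : z + 1 ≠ 0 := by
      simpa using Complex.slitPlane_ne_zero (add_ofReal_mem_slitPlane hz zero_le_one)
    rw [logDivDeriv_zero, logDivDeriv_zero, bernoulliWeight, bernoulliWeight] at h1
    norm_num [Finset.sum_range_succ, psiOneTerm] at h0 h1 ⊢
    field_simp at h0 h1 ⊢
    linear_combination (z * (z + 1)) * h0.symm + h1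
  | succ K ih =>
    have h1 := eulerMaclaurinRemainder_eq (2 * K + 1) hz
    have h2 := eulerMaclaurinRemainder_eq (2 * K + 2) hz
    have hB : bernoulliWeight (2 * K + 2 + 1) 0 = 0 := by
      rw [bernoulliWeight, bernoulliFun_eval_zero,
        bernoulli_eq_zero_of_odd ⟨K + 1, by ring⟩ (by omega)]
      simp
    have hE : ∀ m, m ≠ 1 → bernoulliWeight m 1 = bernoulliWeight m 0 := fun m hm => by
      rw [bernoulliWeight, bernoulliWeight, bernoulliFun_endpoints_eq_of_ne_one hm]
    rw [hE _ (by omega)] at h1 h2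
    rw [hB] at h2
    rw [Finset.sum_range_succ _ (K + 2), Finset.sum_range_succ _ (K + 2), psiOneTerm_add_two,
      psiOneTerm_add_two, show 2 * (K + 1) + 1 = 2 * K + 2 + 1 by ring]
    linear_combination ih - h1 + h2

/-- `psiOne` as a limit of `(log N)²/2` minus a partial sum of `∑ log(z+n)/(z+n)`. -/
theorem tendsto_psiOne (z : ℂ) :
    Tendsto (fun N : ℕ => 1 / 2 * Complex.log N ^ 2
      - ∑ n ∈ Finset.range (N + 1), Complex.log (z + n) / (z + n)) atTop (𝓝 (psiOne z)) := by
  have h1 : Tendsto (fun N => ((stieltjesOneSeq N : ℝ) : ℂ)) atTop (𝓝 (stieltjesOne : ℂ)) :=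
    (Complex.continuous_ofReal.tendsto _).comp tendsto_stieltjesOneSeq
  have h2 := (summable_psiOneSummand z).hasSum.tendsto_sum_nat
  refine ((h1.neg.sub_const (Complex.log z / z)).sub h2).congr fun N => ?_
  rw [stieltjesOneSeq, Finset.sum_range_succ', Finset.range_eq_Ico, Finset.sum_Ico_add'
    (fun n => psiOneSummand z n), Finset.sum_Ico_add'
    (fun n : ℕ => Complex.log (z + n) / (z + n)), zero_add, ← Finset.Ico_add_one_right_eq_Icc]
  simp only [psiOneSummand, Finset.sum_sub_distrib]
  push_cast
  simp only [add_comm z]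
  simp
  ring

/-! ### Growth of the logarithm and of the terms -/

theorem norm_log_le (z : ℂ) (hz : 1 ≤ ‖z‖) : ‖Complex.log z‖ ≤ Real.log ‖z‖ + Real.pi := by
  refine (Complex.norm_le_abs_re_add_abs_im _).trans ?_
  rw [Complex.log_re, Complex.log_im, abs_of_nonneg (Real.log_nonneg hz)]
  gcongr
  exact Complex.abs_arg_le_pi z

theorem tendsto_norm_log_cobounded :
    Tendsto (fun z : ℂ => ‖Complex.log z‖) (Bornology.cobounded ℂ) atTop := by
  refine tendsto_atTop_mono (fun z => ?_) (Real.tendsto_log_atTop.comp tendsto_norm_cobounded_atTop)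
  rw [Function.comp_apply, ← Complex.log_re]
  exact Complex.re_le_norm _

theorem isLittleO_const_log (c : ℂ) :
    (fun _ : ℂ => c) =o[Bornology.cobounded ℂ] Complex.log :=
  isLittleO_const_left.2 (Or.inr tendsto_norm_log_cobounded)

theorem isLittleO_log_id_cobounded : Complex.log =o[Bornology.cobounded ℂ] (fun z : ℂ => z) := by
  have hn : Tendsto (fun z : ℂ => ‖z‖) (Bornology.cobounded ℂ) atTop :=
    tendsto_norm_cobounded_atTop
  have h : (fun z : ℂ => Real.log ‖z‖ + Real.pi) =o[Bornology.cobounded ℂ] (fun z : ℂ => ‖z‖) :=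
    (Real.isLittleO_log_id_atTop.comp_tendsto hn).add
      ((isLittleO_const_id_atTop Real.pi).comp_tendsto hn)
  refine isLittleO_norm_right.1 (IsBigO.trans_isLittleO ?_ h)
  refine IsBigO.of_bound 1 ?_
  filter_upwards [hn.eventually_ge_atTop 1] with z hz
  rw [one_mul]
  exact (norm_log_le z hz).trans (le_abs_self _)

theorem isBigO_inv_pow {a b : ℕ} (h : b ≤ a) :
    (fun z : ℂ => z⁻¹ ^ a) =O[Bornology.cobounded ℂ] (fun z : ℂ => z⁻¹ ^ b) := by
  refine IsBigO.of_bound 1 ?_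
  filter_upwards [tendsto_norm_cobounded_atTop.eventually_ge_atTop (1 : ℝ)] with z hz
  rw [one_mul, norm_pow, norm_pow, norm_inv]
  exact pow_le_pow_of_le_one (by positivity) (inv_le_one_of_one_le₀ hz) h

theorem isLittleO_inv_pow {a b : ℕ} (h : b < a) :
    (fun z : ℂ => z⁻¹ ^ a) =o[Bornology.cobounded ℂ] (fun z : ℂ => z⁻¹ ^ b) := by
  have h0 : (fun z : ℂ => z⁻¹) =o[Bornology.cobounded ℂ] (fun _ : ℂ => (1 : ℂ)) :=
    (isLittleO_one_iff ℂ).2 tendsto_inv₀_cobounded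
  have := (isBigO_inv_pow (Nat.le_sub_one_of_lt h)).mul_isLittleO h0
  refine this.congr (fun z => ?_) (fun z => mul_one _)
  rw [← pow_succ, Nat.sub_add_cancel (by omega)]

theorem bernoulli_two_mul_ne_zero {k : ℕ} (hk : k ≠ 0) : bernoulli (2 * k) ≠ 0 := by
  intro h
  have hs := hasSum_zeta_nat hk
  rw [h] at hs
  have h1 := le_hasSum hs 1 (fun n _ => by positivity)
  norm_num at h1

theorem isTheta_psiOneTerm_zero :
    psiOneTerm 0 =Θ[Bornology.cobounded ℂ] fun z => Complex.log z * Complex.log z := by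
  have : psiOneTerm 0 = fun z => (1 / 2 : ℂ) * (Complex.log z * Complex.log z) := by
    funext z; rw [psiOneTerm, sq]
  rw [this]
  exact (isTheta_const_mul_left (by norm_num)).2 (isTheta_refl _ _)

theorem isTheta_psiOneTerm_one :
    psiOneTerm 1 =Θ[Bornology.cobounded ℂ] fun z => Complex.log z * z⁻¹ ^ 1 := by
  have : psiOneTerm 1 = fun z => (-1 / 2 : ℂ) * (Complex.log z * z⁻¹ ^ 1) := by
    funext z; rw [psiOneTerm]; ring
  rw [this]
  exact (isTheta_const_mul_left (by norm_num)).2 (isTheta_refl _ _)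

theorem isTheta_psiOneTerm_add_two (n : ℕ) :
    psiOneTerm (n + 2) =Θ[Bornology.cobounded ℂ]
      fun z => Complex.log z * z⁻¹ ^ (2 * n + 2) := by
  set H : ℂ := ∑ j ∈ Finset.Icc 1 (2 * (n + 1) - 2), 1 / (j : ℂ)
    + 1 / (2 * ((n + 1 : ℕ) : ℂ) - 1) with hH
  have hlog : (fun z => H - Complex.log z) =Θ[Bornology.cobounded ℂ] Complex.log := by
    have : (fun z => -Complex.log z + H) =Θ[Bornology.cobounded ℂ] fun z => -Complex.log z :=
      IsTheta.add_isLittleO (isTheta_refl _ _) (isLittleO_const_log H).neg_right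
    refine IsTheta.trans ?_ (this.trans ⟨(isBigO_refl _ _).neg_left, (isBigO_refl _ _).neg_right⟩)
    exact EventuallyEq.isTheta (Eventually.of_forall fun z => by ring)
  have hc : ((bernoulli (2 * (n + 1)) : ℚ) : ℂ) / (2 * ((n + 1 : ℕ) : ℂ)) ≠ 0 :=
    div_ne_zero (by exact_mod_cast bernoulli_two_mul_ne_zero (Nat.succ_ne_zero n))
      (mul_ne_zero two_ne_zero (Nat.cast_ne_zero.2 (Nat.succ_ne_zero n)))
  have : psiOneTerm (n + 2) = fun z =>
      ((bernoulli (2 * (n + 1)) : ℚ) : ℂ) / (2 * ((n + 1 : ℕ) : ℂ)) *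
        ((H - Complex.log z) * z⁻¹ ^ (2 * n + 2)) := by
    funext z
    rw [psiOneTerm, bernoulliTerm, ← hH, ← div_div, inv_pow, div_eq_mul_inv _ (z ^ _)]
    ring
  rw [this]
  exact (isTheta_const_mul_left hc).2 (hlog.mul (isTheta_refl _ _))

theorem isLittleO_psiOneTerm_succ (n : ℕ) :
    psiOneTerm (n + 1) =o[Bornology.cobounded ℂ] psiOneTerm n := by
  match n with
  | 0 =>
    rw [isTheta_psiOneTerm_one.isLittleO_congr_left, isTheta_psiOneTerm_zero.isLittleO_congr_right]
    refine (isBigO_refl _ _).mul_isLittleO ?_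
    exact (isBigO_inv_pow (Nat.zero_le 1)).trans_isLittleO (by simpa using isLittleO_const_log 1)
  | 1 =>
    rw [(isTheta_psiOneTerm_add_two 0).isLittleO_congr_left,
      isTheta_psiOneTerm_one.isLittleO_congr_right]
    exact (isBigO_refl _ _).mul_isLittleO (isLittleO_inv_pow (by omega))
  | n + 2 =>
    rw [(isTheta_psiOneTerm_add_two (n + 1)).isLittleO_congr_left,
      (isTheta_psiOneTerm_add_two n).isLittleO_congr_right]
    exact (isBigO_refl _ _).mul_isLittleO (isLittleO_inv_pow (by omega))

theorem isLittleO_inv_pow_log_mul {a b : ℕ} (h : b ≤ a) :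
    (fun z : ℂ => z⁻¹ ^ a) =o[Bornology.cobounded ℂ] fun z => Complex.log z * z⁻¹ ^ b := by
  simpa using (isLittleO_const_log 1).mul_isBigO (isBigO_inv_pow h)

/-- A lower bound for the size of the terms: `psiOneTerm n` is of order `log z ^ p / z ^ e` with
`p ≥ 1` and `e ≤ 2 * n + 1`. -/
theorem isLittleO_inv_pow_psiOneTerm (n : ℕ) :
    (fun z : ℂ => z⁻¹ ^ (2 * n + 1)) =o[Bornology.cobounded ℂ] psiOneTerm n := by
  match n with
  | 0 =>
    rw [isTheta_psiOneTerm_zero.isLittleO_congr_right]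
    refine (isLittleO_inv_pow_log_mul (Nat.zero_le _)).trans_isBigO ?_
    refine (isBigO_refl _ _).mul ?_
    simpa using (isLittleO_const_log 1).isBigO
  | 1 =>
    rw [isTheta_psiOneTerm_one.isLittleO_congr_right]
    exact isLittleO_inv_pow_log_mul (by omega)
  | n + 2 =>
    rw [(isTheta_psiOneTerm_add_two n).isLittleO_congr_right]
    exact isLittleO_inv_pow_log_mul (by omega)

theorem tendsto_psiOneTerm_succ (n : ℕ) :
    Tendsto (psiOneTerm (n + 1)) (Bornology.cobounded ℂ) (𝓝 0) := by
  have h1 : Tendsto (psiOneTerm 1) (Bornology.cobounded ℂ) (𝓝 0) := by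
    rw [← isLittleO_one_iff ℂ, isTheta_psiOneTerm_one.isLittleO_congr_left]
    refine (isLittleO_log_id_cobounded.mul_isBigO (isBigO_refl _ _)).trans_isBigO ?_
    refine IsBigO.of_bound 1 (Eventually.of_forall fun z => ?_)
    rcases eq_or_ne z 0 with rfl | hz
    · simp
    · simp [hz]
  induction n with
  | zero => exact h1
  | succ n ih => exact (isLittleO_psiOneTerm_succ (n + 1)).isBigO.trans_tendsto ih

theorem tendsto_add_natCast_cobounded (z : ℂ) :
    Tendsto (fun N : ℕ => z + N) atTop (Bornology.cobounded ℂ) := by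
  rw [← tendsto_norm_atTop_iff_cobounded]
  refine tendsto_atTop_mono (fun N => ?_)
    (tendsto_atTop_add_const_left _ (-‖z‖) tendsto_natCast_atTop_atTop)
  have := norm_sub_le (z + N) z
  rw [add_sub_cancel_left, Complex.norm_natCast] at this
  linarith

theorem tendsto_log_sq_add_natCast_sub (z : ℂ) :
    Tendsto (fun N : ℕ => 1 / 2 * Complex.log (z + N) ^ 2 - 1 / 2 * Complex.log N ^ 2)
      atTop (𝓝 0) := by
  have hN : Tendsto (fun N : ℕ => (N : ℂ)) atTop (Bornology.cobounded ℂ) := by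
    simpa using tendsto_add_natCast_cobounded 0
  have hinv : Tendsto (fun N : ℕ => z * (N : ℂ)⁻¹) atTop (𝓝 0) := by
    simpa using (tendsto_inv₀_cobounded.comp hN).const_mul z
  have hsmall : ∀ᶠ N : ℕ in atTop, ‖z * (N : ℂ)⁻¹‖ ≤ 1 / 2 :=
    (tendsto_zero_iff_norm_tendsto_zero.1 hinv).eventually_le_const (by norm_num)
  have hd : (fun N : ℕ => Complex.log (1 + z * (N : ℂ)⁻¹)) =O[atTop] fun N : ℕ => (N : ℂ)⁻¹ := by
    refine IsBigO.of_bound (3 / 2 * ‖z‖) ?_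
    filter_upwards [hsmall] with N h
    rw [mul_assoc, ← norm_mul]
    exact Complex.norm_log_one_add_half_le_self h
  have hdL : Tendsto (fun N : ℕ => Complex.log (1 + z * (N : ℂ)⁻¹) * Complex.log N)
      atTop (𝓝 0) := by
    rw [← isLittleO_one_iff ℂ]
    refine (hd.mul_isLittleO (isLittleO_log_id_cobounded.comp_tendsto hN)).trans_isBigO ?_
    refine IsBigO.of_bound 1 ?_
    filter_upwards [eventually_ge_atTop 1] with N h
    have : (N : ℂ) ≠ 0 := by exact_mod_cast (by omega : N ≠ 0)
    simp [this]
  have hd0 : Tendsto (fun N : ℕ => Complex.log (1 + z * (N : ℂ)⁻¹)) atTop (𝓝 0) :=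
    hd.trans_tendsto (tendsto_inv₀_cobounded.comp hN)
  have := hdL.add ((hd0.pow 2).const_mul (1 / 2))
  norm_num at this
  refine this.congr' ?_
  filter_upwards [hsmall, eventually_ge_atTop 1] with N h hN1
  have hN0 : (0 : ℝ) < N := by exact_mod_cast hN1
  have hNc : (N : ℂ) ≠ 0 := by exact_mod_cast hN0.ne'
  have hw : (1 : ℂ) + z * (N : ℂ)⁻¹ ≠ 0 := by
    intro h0
    rw [show z * (N : ℂ)⁻¹ = -1 by linear_combination h0] at h
    norm_num at h
  have hlog : Complex.log (z + N) = Complex.log N + Complex.log (1 + z * (N : ℂ)⁻¹) := by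
    rw [show z + N = (N : ℝ) * (1 + z * (N : ℂ)⁻¹) by push_cast; field_simp; ring,
      Complex.log_ofReal_mul hN0 hw, Complex.natCast_log]
  rw [hlog]
  ring

theorem tendsto_sum_psiOneTerm_add_natCast_sub (K : ℕ) (z : ℂ) :
    Tendsto (fun N : ℕ => ∑ i ∈ Finset.range (K + 1), psiOneTerm i (z + N)
      - 1 / 2 * Complex.log N ^ 2) atTop (𝓝 0) := by
  have h : Tendsto (fun N : ℕ => ∑ i ∈ Finset.range K, psiOneTerm (i + 1) (z + N))
      atTop (𝓝 (∑ i ∈ Finset.range K, 0)) :=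
    tendsto_finsetSum _ fun i _ =>
      (tendsto_psiOneTerm_succ i).comp (tendsto_add_natCast_cobounded z)
  have := h.add (tendsto_log_sq_add_natCast_sub z)
  rw [Finset.sum_const_zero, add_zero] at this
  refine this.congr fun N => ?_
  rw [Finset.sum_range_succ', psiOneTerm]
  ring

/-! ### The remainder in a sector -/

/-- The remainder of the expansion is minus the sum of the Euler–Maclaurin remainders over all the
unit intervals `[z + n, z + n + 1]`. -/
theorem tendsto_sum_eulerMaclaurinRemainder (K : ℕ) {z : ℂ} (hz : z ∈ Complex.slitPlane) :
    Tendsto (fun N : ℕ => -∑ n ∈ Finset.range (N + 1), eulerMaclaurinRemainder (2 * K + 1) (z + n))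
      atTop (𝓝 (psiOne z - ∑ i ∈ Finset.range (K + 2), psiOneTerm i z)) := by
  have h := ((tendsto_psiOne z).add
    (tendsto_sum_psiOneTerm_add_natCast_sub (K + 1) (z + 1))).sub_const
      (∑ i ∈ Finset.range (K + 2), psiOneTerm i z)
  rw [add_zero] at h
  refine h.congr fun N => ?_
  have hstep : ∀ n : ℕ, eulerMaclaurinRemainder (2 * K + 1) (z + n)
      = Complex.log (z + n) / (z + n)
        - (∑ i ∈ Finset.range (K + 2), psiOneTerm i (z + (n + 1 : ℕ))
          - ∑ i ∈ Finset.range (K + 2), psiOneTerm i (z + n)) := fun n => by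
    have hn : z + n ∈ Complex.slitPlane := by
      simpa using add_ofReal_mem_slitPlane hz (Nat.cast_nonneg n)
    have := sum_psiOneTerm_add_one_sub K hn
    rw [Nat.cast_add_one, ← add_assoc]
    linear_combination this
  rw [Finset.sum_congr rfl fun n _ => hstep n, Finset.sum_sub_distrib,
    Finset.sum_range_sub (fun n : ℕ => ∑ i ∈ Finset.range (K + 2), psiOneTerm i (z + n))]
  rw [show z + ((N + 1 : ℕ) : ℂ) = z + 1 + N by push_cast; ring]
  simp
  ring

theorem mem_slitPlane_of_abs_arg_le {δ : ℝ} (hδ : 0 < δ) {z : ℂ} (hz0 : z ≠ 0)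
    (hz : |z.arg| ≤ Real.pi - δ) : z ∈ Complex.slitPlane := by
  rw [Complex.mem_slitPlane_iff_arg]
  refine ⟨fun h => ?_, hz0⟩
  rw [h, abs_of_pos Real.pi_pos] at hz
  linarith

/-- In the sector `|arg z| ≤ π - δ` the law of cosines gives
`‖z + t‖² ≥ ‖z‖² + t² - 2 t ‖z‖ cos δ`, which is at least `(1 - cos δ)/2 * (‖z‖ + t)²`. -/
theorem le_norm_add_of_abs_arg_le {δ : ℝ} (hδ : 0 ≤ δ) {z : ℂ}
    (hz : |z.arg| ≤ Real.pi - δ) {t : ℝ} (ht : 0 ≤ t) :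
    √((1 - Real.cos δ) / 2) * (‖z‖ + t) ≤ ‖z + t‖ := by
  have hcos : -Real.cos δ ≤ Real.cos z.arg := by
    rw [← Real.cos_pi_sub, ← Real.cos_abs z.arg]
    exact Real.cos_le_cos_of_nonneg_of_le_pi (abs_nonneg _) (by linarith) hz
  have hre : -(‖z‖ * Real.cos δ) ≤ z.re := by
    rw [← Complex.norm_mul_cos_arg z]
    nlinarith [norm_nonneg z]
  have hsq : ‖z + t‖ ^ 2 = ‖z‖ ^ 2 + t ^ 2 + 2 * t * z.re := by
    rw [Complex.sq_norm, Complex.sq_norm, Complex.normSq_apply, Complex.normSq_apply]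
    simp
    ring
  have hc := Real.cos_le_one δ
  refine abs_le_of_sq_le_sq' ?_ (norm_nonneg _) |>.2
  rw [mul_pow, Real.sq_sqrt (by linarith), hsq]
  nlinarith [mul_le_mul_of_nonneg_left hre ht,
    mul_nonneg (by linarith [Real.neg_one_le_cos δ] : 0 ≤ 1 + Real.cos δ) (sq_nonneg (‖z‖ - t))]

theorem exists_norm_logDivDeriv_le (m : ℕ) :
    ∃ C, 0 ≤ C ∧ ∀ w : ℂ, 1 ≤ ‖w‖ → ‖logDivDeriv m w‖ ≤ C / ‖w‖ ^ m := by
  refine ⟨m.factorial * (1 + Real.pi + ‖((harmonic m : ℚ) : ℂ)‖),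
    by positivity, fun w hw => ?_⟩
  have hw0 : 0 < ‖w‖ := by linarith
  have hlog : ‖Complex.log w‖ ≤ (1 + Real.pi) * ‖w‖ := by
    have := Real.log_le_sub_one_of_pos hw0
    nlinarith [norm_log_le w hw, Real.pi_pos]
  rw [logDivDeriv, norm_div, norm_mul, norm_mul, norm_pow, norm_neg, norm_one, one_pow, one_mul,
    norm_pow, Complex.norm_natCast, div_le_div_iff₀ (by positivity) (by positivity)]
  have : ‖Complex.log w - ((harmonic m : ℚ) : ℂ)‖
      ≤ (1 + Real.pi + ‖((harmonic m : ℚ) : ℂ)‖) * ‖w‖ := by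
    refine (norm_sub_le _ _).trans ?_
    nlinarith [norm_nonneg ((harmonic m : ℚ) : ℂ)]
  calc _ ≤ m.factorial * ((1 + Real.pi + ‖((harmonic m : ℚ) : ℂ)‖) * ‖w‖) * ‖w‖ ^ m := by gcongr
    _ = _ := by ring

theorem exists_norm_eulerMaclaurinRemainder_le (m : ℕ) :
    ∃ C, 0 ≤ C ∧ ∀ (z : ℂ) (r : ℝ), 1 ≤ r → (∀ t : ℝ, 0 ≤ t → r ≤ ‖z + t‖) →
      ‖eulerMaclaurinRemainder m z‖ ≤ C / r ^ m := by
  obtain ⟨C, hC0, hC⟩ := exists_norm_logDivDeriv_le m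
  obtain ⟨B, hB⟩ := (isCompact_Icc (a := (0 : ℝ)) (b := 1)).exists_bound_of_continuousOn
    (continuous_bernoulliWeight m).continuousOn
  have hB0 : 0 ≤ B := (norm_nonneg _).trans (hB 0 (by simp))
  refine ⟨B * C, by positivity, fun z r hr hz => ?_⟩
  have := intervalIntegral.norm_integral_le_of_norm_le_const (a := 0) (b := 1)
    (C := B * (C / r ^ m)) (f := fun t => bernoulliWeight m t * logDivDeriv m (z + t))
    (fun t ht => by
      rw [Set.uIoc_of_le zero_le_one] at ht
      rw [norm_mul]
      have h1 := hz t ht.1.le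
      gcongr
      · exact hB t ⟨ht.1.le, ht.2⟩
      · exact (hC _ (hr.trans h1)).trans (by gcongr))
  simpa [eulerMaclaurinRemainder, mul_div_assoc] using this

/-- The remainder of the partial sum of `n + 3` terms is `O(z^{-(2n+1)})` in a sector. The
exponent is not the optimal one (`log` is estimated by the identity, and the sum over unit intervals
crudely), but it is enough for the comparison with the term of index `n`. -/
theorem isBigO_psiOne_sub_sum {δ : ℝ} (hδ : 0 < δ) (hδ' : δ ≤ Real.pi) (n : ℕ) :
    (fun z => psiOne z - ∑ i ∈ Finset.range (n + 3), psiOneTerm i z)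
      =O[atInftyInSector δ] fun z : ℂ => z⁻¹ ^ (2 * n + 1) := by
  obtain ⟨C, hC0, hC⟩ := exists_norm_eulerMaclaurinRemainder_le (2 * (n + 1) + 1)
  set c : ℝ := √((1 - Real.cos δ) / 2) with hc
  have hcpos : 0 < c := by
    have := Real.cos_lt_cos_of_nonneg_of_le_pi le_rfl hδ' hδ
    rw [Real.cos_zero] at this
    exact Real.sqrt_pos.2 (by linarith)
  have hsum : Summable fun k : ℕ => 1 / ((k : ℝ) + 1) ^ 2 := by
    have := (summable_nat_add_iff 1).2 (Real.summable_one_div_nat_pow.2 one_lt_two)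
    simpa using this
  refine IsBigO.of_bound (C / c ^ (2 * n + 3) * ∑' k : ℕ, 1 / ((k : ℝ) + 1) ^ 2) ?_
  rw [atInftyInSector, eventually_inf_principal]
  filter_upwards [tendsto_norm_cobounded_atTop.eventually_ge_atTop (1 : ℝ),
    tendsto_norm_cobounded_atTop.eventually_ge_atTop (1 / c)] with z hz1 hzc hz
  have hz0 : 0 < ‖z‖ := by linarith
  have hslit := mem_slitPlane_of_abs_arg_le hδ (norm_pos_iff.1 hz0) hz
  have hterm : ∀ k : ℕ, ‖eulerMaclaurinRemainder (2 * (n + 1) + 1) (z + k)‖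
      ≤ C / c ^ (2 * n + 3) * (1 / ‖z‖ ^ (2 * n + 1)) * (1 / ((k : ℝ) + 1) ^ 2) := fun k => by
    have hr : 1 ≤ c * (‖z‖ + k) := by
      rw [div_le_iff₀ hcpos] at hzc
      nlinarith [mul_nonneg hcpos.le (Nat.cast_nonneg (α := ℝ) k)]
    refine (hC (z + k) (c * (‖z‖ + k)) hr fun t ht => ?_).trans ?_
    · have := le_norm_add_of_abs_arg_le hδ.le hz (add_nonneg (Nat.cast_nonneg (α := ℝ) k) ht)
      push_cast at this
      rw [← add_assoc, ← add_assoc] at this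
      exact (mul_le_mul_of_nonneg_left (le_add_of_nonneg_right ht) hcpos.le).trans this
    · -- one factor `(‖z‖ + k)²` makes the sum over `k` converge, the others give the decay in `z`
      rw [mul_pow, div_mul_div_comm, div_mul_div_comm, mul_one, mul_one]
      rw [mul_assoc, show 2 * (n + 1) + 1 = 2 * n + 3 by ring, pow_add (‖z‖ + k) (2 * n + 1) 2]
      have h1 : ‖z‖ ≤ ‖z‖ + k := le_add_of_nonneg_right (Nat.cast_nonneg k)
      have h2 : (k : ℝ) + 1 ≤ ‖z‖ + k := by linarith
      gcongr
  refine le_of_tendsto (tendsto_sum_eulerMaclaurinRemainder (n + 1) hslit).norm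
    (Eventually.of_forall fun N => ?_)
  rw [norm_neg]
  calc _ ≤ ∑ k ∈ Finset.range (N + 1),
        C / c ^ (2 * n + 3) * (1 / ‖z‖ ^ (2 * n + 1)) * (1 / ((k : ℝ) + 1) ^ 2) :=
        norm_sum_le_of_le _ fun k _ => hterm k
    _ ≤ C / c ^ (2 * n + 3) * (1 / ‖z‖ ^ (2 * n + 1)) * ∑' k : ℕ, 1 / ((k : ℝ) + 1) ^ 2 := by
        rw [← Finset.mul_sum]
        gcongr
        exact hsum.sum_le_tsum _ fun k _ => by positivity
    _ = _ := by
        rw [norm_pow, norm_inv, inv_pow, one_div]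
        ring

/-! ### The asymptotic expansion -/

theorem atInftyInSector_anti {δ δ' : ℝ} (h : δ' ≤ δ) : atInftyInSector δ ≤ atInftyInSector δ' :=
  inf_le_inf_left _ (principal_mono.2 fun _ hz => le_trans hz (sub_le_sub_left h _))

theorem theorem3p2 (δ : ℝ) (hδ : 0 < δ) :
    HasAsymptoticExpansion (atInftyInSector δ) psiOne psiOneTerm := by
  have hsucc : ∀ n, psiOneTerm (n + 1) =o[atInftyInSector δ] psiOneTerm n := fun n =>
    (isLittleO_psiOneTerm_succ n).mono inf_le_left
  refine ⟨hsucc, fun n => ?_⟩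
  -- for `δ > π` the sector is empty, so `δ` may be replaced by `min δ π`
  have hR := ((isBigO_psiOne_sub_sum (lt_min hδ Real.pi_pos) (min_le_right _ _) n).mono
    (atInftyInSector_anti (min_le_left δ Real.pi))).trans_isLittleO
    ((isLittleO_inv_pow_psiOneTerm n).mono inf_le_left)
  refine ((hR.add (hsucc n)).add ((hsucc (n + 1)).trans (hsucc n))).congr_left fun z => ?_
  rw [Finset.sum_range_succ _ (n + 2), Finset.sum_range_succ _ (n + 1)]
  ring
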